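/- Let $X$ be a real linear Polish space (a real topological vector space whose topology is Polish), let $D\subseteq X$ be nonempty, open and convex, let $Y$ be a real linear topological space, and let $n\in\mathbb{N}$. A set $A\subseteq X$ is called Haar meager if there are a Borel set $B\supseteq A$, a nonempty compact metric space $K$ and a continuous map $g:K\to X$ such that $g^{-1}(B+x)$ is meager in $K$ for every $x\in X$. A set $A\subseteq X$ is called $\mathcal{D}$-measurable if $A=B\cup M$ for some Borel set $B\subseteq X$ and some Haar meager set $M\subseteq X$. A function $f:D\to Y$ is called $\mathcal{D}$-measurable if $f^{-1}(U)$ is a $\mathcal{D}$-measurable subset of $X$ for every open $U\subseteq Y$. It is called a polynomial function of $n$-th order if $$\Delta_h^{n+1}f(x):=\sum_{j=0}^{n+1}(-1)^{n+1-j}\binom{n+1}{j}f(x+jh)=0$$ for all $x\in D$ and $h\in X$ such that $x+ih\in D$ for $i\in\{0,1,\ldots,n+1\}$. **Theorem.** Every $\mathcal{D}$-measurable polynomial function $f:D\to Y$ of $n$-th order is continuous. -/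

import Mathlib

open Set

/-- `A` is Haar meager: it is contained in a Borel set `B` for which there are a nonempty compact
metric space `K` and a continuous `g : K → X` such that every preimage `g⁻¹(B + x)` is meager
in `K`. Every compact metric space has a homeomorphic copy in `Type`. -/
def HaarMeager {X : Type*} [AddCommGroup X] [TopologicalSpace X] [MeasurableSpace X]
    (A : Set X) : Prop :=
  ∃ B : Set X, MeasurableSet B ∧ A ⊆ B ∧
    ∃ (K : Type) (_ : MetricSpace K) (_ : CompactSpace K) (_ : Nonempty K) (g : K → X),
      Continuous g ∧ ∀ x : X, IsMeagre (g ⁻¹' ((fun b => b + x) '' B))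

/-- `A` is `𝒟`-measurable: the union of a Borel set and a Haar meager set. -/
def DMeasurableSet {X : Type*} [AddCommGroup X] [TopologicalSpace X] [MeasurableSpace X]
    (A : Set X) : Prop :=
  ∃ B M : Set X, MeasurableSet B ∧ HaarMeager M ∧ A = B ∪ M

/-- `f : D → Y` is `𝒟`-measurable: the preimage of every open set, as a subset of `X`,
is `𝒟`-measurable. -/
def DMeasurable {X Y : Type*} [AddCommGroup X] [TopologicalSpace X] [MeasurableSpace X]
    [TopologicalSpace Y] {D : Set X} (f : D → Y) : Prop :=
  ∀ U : Set Y, IsOpen U → DMeasurableSet ((Subtype.val : D → X) '' (f ⁻¹' U))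

/-- `f : D → Y` is a polynomial function of `n`-th order: the difference
`Δ_h^{n+1} f(x) = ∑_{j=0}^{n+1} (-1)^{n+1-j} (n+1 choose j) f(x + j h)` vanishes for all `x`, `h`
such that `x + i h ∈ D` for `i = 0, …, n + 1`. -/
def IsPolynomialFunction {X Y : Type*} [AddCommGroup X] [AddCommGroup Y] {D : Set X}
    (n : ℕ) (f : D → Y) : Prop :=
  ∀ (x h : X) (hx : ∀ i : Fin (n + 2), x + (i : ℕ) • h ∈ D),
    ∑ j : Fin (n + 2),
      ((-1 : ℤ) ^ (n + 1 - (j : ℕ)) * ((n + 1).choose (j : ℕ) : ℤ)) •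
        f ⟨x + (j : ℕ) • h, hx j⟩ = 0

open Filter Topology fwdDiff fwdDiff_aux Pointwise

/-! Continuity at a point is local, so the point is moved to the origin. For an open neighbourhood
`W` of 0 in `Y`, the preimages of the multiples `(i+1)W` cover `D`. Countably many Haar meager sets
cannot cover a nonempty open set (`IsOpen.not_subset_iUnion_haarMeager`), so close to the point one
of these preimages has a Borel part that is not Haar meager. By a Steinhaus-type theorem
(`MeasurableSet.haarMeager_of_not_steinhausSet`) it contains a progression a, a+u, …, a+pu for every
small u, and `f` is controlled along it.

If the (p+1)-st differences of `f` vanish near 0, Djoković's identity makes Δ_u^p f independent of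
the base point near 0. Hence the leading part Δ_u^p f(0)/p! is absorbed by multiples of `W`, and its
homogeneity of degree p upgrades this to continuity at 0. Subtracting it lowers the order and keeps
the boundedness, so induction on the order concludes. -/

/-! ### Completeness of Polish abelian groups and convergent series -/

lemma cauchySeq_tendsto_of_isInducing {X Z : Type*} [AddCommGroup X] [UniformSpace X]
    [IsUniformAddGroup X] [BaireSpace X] [MetricSpace Z] [CompleteSpace Z] (e : X → Z)
    (he : IsInducing e) (hs : Function.Surjective e) {s : ℕ → X} (hc : CauchySeq s) :
    ∃ x, Tendsto s atTop (𝓝 x) := by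
  have hec := he.continuous
  have hsub : Tendsto (fun q : ℕ × ℕ => s q.1 - s q.2) (atTop ×ˢ atTop) (𝓝 0) := by
    have h := cauchySeq_iff_tendsto.1 hc
    rw [uniformity_eq_comap_nhds_zero_swapped, tendsto_comap_iff, ← prod_atTop_atTop_eq] at h
    simpa [Function.comp_def] using h
  -- By Baire, some x lies in every `O k`. Then e(s n + x) is Cauchy in the complete space, so s n +
  -- x converges, and hence so does s n.
  let O : ℕ → Set X := fun k => {x | ∃ U : Set X, IsOpen U ∧ x ∈ U ∧ ∃ N, ∀ n ≥ N, ∀ m ≥ N,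
    ∀ y ∈ U, dist (e (s n + y)) (e (s m + y)) ≤ 1 / (k + 1)}
  have hO : ∀ k, IsOpen (O k) := by
    intro k
    rw [isOpen_iff_mem_nhds]
    rintro x ⟨U, hU, hx, N, h⟩
    exact mem_of_superset (hU.mem_nhds hx) fun y hy => ⟨U, hU, hy, N, h⟩
  have hd : ∀ k, Dense (O k) := by
    intro k x0
    rw [mem_closure_iff_nhds]
    intro P hP
    have h1 : ∀ᶠ q : ℕ × ℕ in atTop ×ˢ atTop, x0 + (s q.1 - s q.2) ∈ P := by
      have : Tendsto (fun q : ℕ × ℕ => x0 + (s q.1 - s q.2)) (atTop ×ˢ atTop) (𝓝 (x0 + 0)) :=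
        tendsto_const_nhds.add hsub
      rw [add_zero] at this
      exact this hP
    obtain ⟨M, hM⟩ := (eventually_atTop_prod_self.1 (prod_atTop_atTop_eq (α := ℕ) (β := ℕ) ▸ h1))
    set y := x0 + s M with hy
    have hball : e ⁻¹' Metric.ball (e y) (1 / (2 * (k + 1))) ∈ 𝓝 y :=
      hec.continuousAt (Metric.ball_mem_nhds _ (by positivity))
    have h2 : Tendsto (fun q : (ℕ × ℕ) × X => (s q.1.1 - s q.1.2) + (y + q.2))
        ((atTop ×ˢ atTop) ×ˢ 𝓝 0) (𝓝 (0 + (y + 0))) :=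
      (hsub.comp tendsto_fst).add (tendsto_const_nhds.add tendsto_snd)
    rw [zero_add, add_zero] at h2
    obtain ⟨p, hp, q, hq, hpq⟩ := eventually_prod_iff.1 (h2 hball)
    rw [prod_atTop_atTop_eq] at hp
    obtain ⟨N, hN⟩ := eventually_atTop_prod_self.1 hp
    obtain ⟨U, hU, hUo, hU0⟩ := mem_nhds_iff.1 hq
    set m := max M N with hm
    refine ⟨x0 + (s M - s m), hM M m le_rfl (le_max_left _ _),
      (fun z => z - (x0 + (s M - s m))) ⁻¹' U, hUo.preimage (by fun_prop), by simpa using hU0, m, ?_⟩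
    have h3 : ∀ n ≥ m, ∀ z ∈ (fun z => z - (x0 + (s M - s m))) ⁻¹' U,
        dist (e (s n + z)) (e y) < 1 / (2 * (k + 1)) := by
      intro n hn z hz
      have := hpq (hN n m ((le_max_right _ _).trans hn) (le_max_right _ _)) (hU hz)
      have h4 : s n - s m + (y + (z - (x0 + (s M - s m)))) = s n + z := by rw [hy]; abel
      simpa [h4] using this
    intro n hn n' hn' z hz
    have h5 := dist_triangle_right (e (s n + z)) (e (s n' + z)) (e y)
    have h6 := h3 n hn z hz
    have h7 := h3 n' hn' z hz
    have : (1 : ℝ) / (2 * (k + 1)) + 1 / (2 * (k + 1)) = 1 / (k + 1) := by field_simp; norm_num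
    linarith
  obtain ⟨x, hx⟩ := (dense_iInter_of_isOpen hO hd).nonempty
  rw [mem_iInter] at hx
  have hcx : CauchySeq fun n => e (s n + x) := by
    rw [Metric.cauchySeq_iff]
    intro ε hε
    obtain ⟨k, hk⟩ := exists_nat_one_div_lt hε
    obtain ⟨U, -, hxU, N, h⟩ := hx k
    exact ⟨N, fun n hn m hm => (h n hn m hm x hxU).trans_lt hk⟩
  obtain ⟨z, hz⟩ := cauchySeq_tendsto_of_complete hcx
  obtain ⟨w, rfl⟩ := hs z
  have h8 : Tendsto (fun n => s n + x) atTop (𝓝 w) := he.tendsto_nhds_iff.2 hz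
  exact ⟨w - x, by simpa using h8.sub_const x⟩

/-- A topological abelian group whose topology is completely metrizable is complete. -/
lemma completeSpace_of_isCompletelyMetrizableSpace {X : Type*} [AddCommGroup X] [UniformSpace X]
    [IsUniformAddGroup X] [hX : TopologicalSpace.IsCompletelyMetrizableSpace X] : CompleteSpace X := by
  have : (uniformity X).IsCountablyGenerated :=
    IsUniformAddGroup.uniformity_countably_generated
  refine UniformSpace.complete_of_cauchySeq_tendsto fun s hs => ?_
  obtain ⟨m, hm, hc⟩ := hX.complete
  exact @cauchySeq_tendsto_of_isInducing X X _ _ _ _ m hc (fun x => x)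
    (@IsInducing.mk X X _ m.toUniformSpace.toTopologicalSpace _ (by rw [hm]; exact induced_id.symm))
    Function.surjective_id s hs


/-- In a Polish abelian group there are neighbourhoods `V n` of `0` such that series of
continuous maps into them converge to a continuous map on the product of the domains. -/
lemma exists_nhds_forall_exists_continuous_sum (X : Type*) [AddCommGroup X] [TopologicalSpace X]
    [IsTopologicalAddGroup X] [PolishSpace X] :
    ∃ V : ℕ → Set X, (∀ n, V n ∈ 𝓝 0) ∧
      ∀ (K : ℕ → Type) [∀ n, TopologicalSpace (K n)] (g : ∀ n, K n → X),
        (∀ n, Continuous (g n)) → (∀ n k, g n k ∈ V n) →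
        ∃ G : (∀ n, K n) → X, Continuous G ∧
          ∀ t n s, G (Function.update t n s) = G t + (g n s - g n (t n)) := by
  let _ := IsTopologicalAddGroup.rightUniformSpace X
  have : IsUniformAddGroup X := isUniformAddGroup_of_addCommGroup
  have : CompleteSpace X := completeSpace_of_isCompletelyMetrizableSpace
  obtain ⟨u, hu, hadd⟩ := IsTopologicalAddGroup.exists_antitone_basis_nhds_zero X
  refine ⟨fun n => u (n + 1), fun n => hu.1.mem_of_mem trivial, fun K _ g hg hgV => ?_⟩
  -- Peel off the lowest term: it and the remaining sum both lie in u (N+1), and u (N+1) + u (N+1) ⊆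
  -- u N.
  have hsum : ∀ (t : ∀ n, K n) (N k : ℕ),
      ∑ i ∈ Finset.Ico N (N + k), g i (t i) ∈ u N := by
    intro t N k
    induction k generalizing N with
    | zero => simpa using mem_of_mem_nhds (hu.1.mem_of_mem trivial)
    | succ k ih =>
      rw [Finset.sum_eq_sum_Ico_succ_bot (by omega)]
      have := ih (N + 1)
      rw [show N + 1 + k = N + (k + 1) by ring] at this
      exact hadd N (add_mem_add (hgV N (t N)) this)
  let S : ℕ → (∀ n, K n) → X := fun N t => ∑ i ∈ Finset.range N, g i (t i)
  have hS : ∀ t N M, N ≤ M → S M t - S N t ∈ u N := by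
    intro t N M h
    obtain ⟨k, rfl⟩ := Nat.exists_eq_add_of_le h
    rw [← Finset.sum_Ico_eq_sub _ h]
    exact hsum t N k
  have hU : UniformCauchySeqOn S atTop univ := by
    intro W hW
    rw [uniformity_eq_comap_nhds_zero, mem_comap] at hW
    obtain ⟨P, hP, hPW⟩ := hW
    obtain ⟨Q, hQ, hQP⟩ := exists_nhds_half_neg hP
    obtain ⟨k, -, hk⟩ := hu.1.mem_iff.1 hQ
    filter_upwards [(eventually_ge_atTop k).prod_mk (eventually_ge_atTop k)] with m hm t _
    refine hPW ?_
    have := hQP _ (hk (hS t k m.2 hm.2)) _ (hk (hS t k m.1 hm.1))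
    simpa using this
  have hconv : ∀ t, ∃ x, Tendsto (fun N => S N t) atTop (𝓝 x) := fun t =>
    cauchySeq_tendsto_of_complete (hU.cauchySeq (mem_univ t))
  choose G hG using hconv
  have hunif : TendstoUniformlyOn S G atTop univ := hU.tendstoUniformlyOn_of_tendsto fun t _ => hG t
  refine ⟨G, (tendstoUniformlyOn_univ.1 hunif).continuous (Frequently.of_forall fun N => ?_), ?_⟩
  · exact continuous_finsetSum _ fun i _ => (hg i).comp (continuous_apply i)
  · intro t n s
    have h1 : ∀ᶠ N in atTop, S N t + (g n s - g n (t n)) = S N (Function.update t n s) := by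
      filter_upwards [eventually_gt_atTop n] with N hN
      simp only [S]
      rw [← Finset.sum_erase_add _ _ (Finset.mem_range.2 hN),
        ← Finset.sum_erase_add (a := n) (Finset.range N) (fun i => g i (Function.update t n s i))
          (Finset.mem_range.2 hN)]
      have : ∑ x ∈ (Finset.range N).erase n, g x (Function.update t n s x)
          = ∑ x ∈ (Finset.range N).erase n, g x (t x) :=
        Finset.sum_congr rfl fun i hi => by rw [Function.update_of_ne (Finset.ne_of_mem_erase hi)]
      rw [this, Function.update_self]
      abel
    exact tendsto_nhds_unique (hG _) (((hG t).add_const _).congr' h1)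

lemma HaarMeager.preimage_image_add {X K : Type*} [AddCommGroup X] (g : K → X) (B : Set X) (x : X) :
    g ⁻¹' ((fun b => b + x) '' B) = {k | g k - x ∈ B} := by
  ext k; simp [sub_eq_add_neg]

/-! ### Steinhaus property of Borel sets that are not Haar meager -/

/-- `A` contains, for every length, short arithmetic progressions with any sufficiently small
difference. -/
def SteinhausSet {X : Type*} [AddCommGroup X] [TopologicalSpace X] (A : Set X) : Prop :=
  ∀ p : ℕ, ∀ᶠ u in 𝓝 (0 : X), ∃ a, ∀ j ≤ p, a + j • u ∈ A

/-- Failure at length p yields rapidly decreasing x_n such that `B` contains no progression a,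
a+x_n, …, a+p·x_n. The witness is t ↦ ∑ t_n x_n on the cube of digits 0, …, p: were a preimage
nonmeager, it would be comeager in an open set, and varying one far digit of a generic point would
produce a forbidden progression. -/
lemma MeasurableSet.haarMeager_of_not_steinhausSet {X : Type*} [AddCommGroup X]
    [TopologicalSpace X] [IsTopologicalAddGroup X] [PolishSpace X] [MeasurableSpace X]
    [BorelSpace X] {B : Set X} (hB : MeasurableSet B) (hS : ¬ SteinhausSet B) : HaarMeager B := by
  obtain ⟨V, hV, hsum⟩ := exists_nhds_forall_exists_continuous_sum X
  simp only [SteinhausSet, not_forall] at hS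
  obtain ⟨p, hp⟩ := hS
  have hx : ∀ n, ∃ x : X, (¬ ∃ a, ∀ j ≤ p, a + j • x ∈ B) ∧ ∀ j : Fin (p + 1), (j : ℕ) • x ∈ V n := by
    intro n
    refine (Filter.not_eventually.1 hp |>.and_eventually ?_).exists
    rw [eventually_all]
    intro j
    have : Tendsto (fun x : X => (j : ℕ) • x) (𝓝 0) (𝓝 ((j : ℕ) • 0)) :=
      (continuous_nsmul (j : ℕ)).tendsto 0
    rw [smul_zero] at this
    exact this (hV n)
  choose x hxB hxV using hx
  obtain ⟨G, hG, hGu⟩ := hsum (fun _ => Fin (p + 1)) (fun n j => (j : ℕ) • x n)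
    (fun n => continuous_of_discreteTopology) (fun n j => hxV n j)
  let _ : MetricSpace (ℕ → Fin (p + 1)) := TopologicalSpace.metrizableSpaceMetric _
  refine ⟨B, hB, Subset.rfl, ℕ → Fin (p + 1), inferInstance, inferInstance, inferInstance, G, hG,
    fun y => ?_⟩
  rw [HaarMeager.preimage_image_add]
  set E := {t | G t - y ∈ B} with hE
  borelize (ℕ → Fin (p + 1))
  have hEm : MeasurableSet E := (hG.sub continuous_const).measurable hB
  obtain ⟨U, hU, hEU⟩ := hEm.residualEq_isOpen
  rcases U.eq_empty_or_nonempty with rfl | ⟨t0, ht0⟩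
  · filter_upwards [hEU.mem_iff] with t ht
    simpa using ht
  exfalso
  have hn : ∀ᶠ n in atTop, ∀ s : Fin (p + 1), t0 + Pi.single n s ∈ U := by
    rw [eventually_all]
    intro s
    have : Tendsto (fun n => t0 + Pi.single n s) atTop (𝓝 t0) := by
      rw [tendsto_pi_nhds]
      intro i
      refine tendsto_const_nhds.congr' ?_
      filter_upwards [eventually_gt_atTop i] with n hn
      simp [hn.ne]
    exact this (hU.mem_nhds ht0)
  obtain ⟨n, hn⟩ := hn.exists
  -- Addition in `Fin (p + 1)` is cyclic, so shifting digit n is a homeomorphism of the cube and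
  -- preserves residual sets.
  have hres : ∀ᶠ t in residual (ℕ → Fin (p + 1)), ∀ s : Fin (p + 1),
      (t + Pi.single n s ∈ E ↔ t + Pi.single n s ∈ U) := by
    rw [eventually_all]
    intro s
    have h := Homeomorph.residual_map_eq (Homeomorph.addRight (Pi.single n s : ℕ → Fin (p + 1)))
    have h2 := hEU.mem_iff
    rw [← h, eventually_map] at h2
    exact h2
  have hWo : IsOpen {t : ℕ → Fin (p + 1) | ∀ s : Fin (p + 1), t + Pi.single n s ∈ U} := by
    simp only [ofPred_forall]
    exact isOpen_iInter_of_finite fun s => hU.preimage (by fun_prop)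
  obtain ⟨t, htW, htE⟩ := (dense_of_mem_residual hres).inter_open_nonempty _ hWo ⟨t0, hn⟩
  refine hxB n ⟨G (Function.update t n 0) - y, fun j hj => ?_⟩
  have h1 := hGu (Function.update t n 0) n (Fin.ofNat (p + 1) j)
  have h2 : t + Pi.single n (Fin.ofNat (p + 1) j - t n)
      = Function.update t n (Fin.ofNat (p + 1) j) := by
    ext i
    rcases eq_or_ne i n with rfl | hi
    · simp
    · simp [hi]
  have h3 := (htE (Fin.ofNat (p + 1) j - t n)).2 (htW _)
  rw [h2] at h3
  rw [Function.update_idem, Function.update_self] at h1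
  simp only [hE, mem_ofPred_eq, h1] at h3
  convert h3 using 1
  have : ((Fin.ofNat (p + 1) j : Fin (p + 1)) : ℕ) = j := by
    simp [Fin.ofNat, Nat.mod_eq_of_lt (Nat.lt_succ_of_le hj)]
  rw [this]
  simp
  abel

/-! ### Kuratowski–Ulam and countable unions of Haar meager sets -/

/-- Kuratowski–Ulam: almost every section of a residual set is residual. -/
lemma eventually_residual_prod {K L : Type*} [TopologicalSpace K] [TopologicalSpace L]
    [SecondCountableTopology K] {M : Set (K × L)} (hM : M ∈ residual (K × L)) :
    ∀ᶠ l in residual L, ∀ᶠ k in residual K, (k, l) ∈ M := by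
  obtain ⟨S, hSo, hSd, hSc, hSM⟩ := mem_residual_iff.1 hM
  have h : ∀ s ∈ S, ∀ᶠ l in residual L, ∀ᶠ k in residual K, (k, l) ∈ s := by
    intro s hs
    obtain ⟨b, hbc, hbe, hb⟩ := TopologicalSpace.exists_countable_basis K
    have h1 : ∀ O ∈ b, ∀ᶠ l in residual L, ∃ k ∈ O, (k, l) ∈ s := by
      intro O hO
      refine residual_of_dense_open ?_ ?_
      · have : {l | ∃ k ∈ O, (k, l) ∈ s} = ⋃ k ∈ O, (fun l => (k, l)) ⁻¹' s := by ext; simp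
        change IsOpen {l | ∃ k ∈ O, (k, l) ∈ s}
        rw [this]
        exact isOpen_biUnion fun k _ => (hSo s hs).preimage (by fun_prop)
      · rw [dense_iff_inter_open]
        intro P hP hPne
        have hOne : O.Nonempty := nonempty_iff_ne_empty.2 fun h => hbe (h ▸ hO)
        obtain ⟨⟨k, l⟩, hkl, hs'⟩ := (hSd s hs).inter_open_nonempty (O ×ˢ P)
          ((hb.isOpen hO).prod hP) (hOne.prod hPne)
        exact ⟨l, hkl.2, k, hkl.1, hs'⟩
    filter_upwards [(eventually_countable_ball hbc).2 h1] with l hl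
    refine residual_of_dense_open (s := {k | (k, l) ∈ s}) ((hSo s hs).preimage (by fun_prop)) ?_
    rw [hb.dense_iff]
    intro O hO _
    obtain ⟨k, hk, hks⟩ := hl O hO
    exact ⟨k, hk, hks⟩
  filter_upwards [(eventually_countable_ball hSc).2 h] with l hl
  filter_upwards [(eventually_countable_ball hSc).2 hl] with k hk
  exact hSM hk

/-- Otherwise the set is comeager in some open rectangle, and a generic section would be both meager
and comeager on a nonempty open set. -/
lemma BaireMeasurableSet.isMeagre_of_sections {K L : Type*} [TopologicalSpace K]
    [TopologicalSpace L] [SecondCountableTopology K] [BaireSpace K] [BaireSpace L]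
    {E : Set (K × L)} (hE : BaireMeasurableSet E) (hs : ∀ l, IsMeagre {k | (k, l) ∈ E}) :
    IsMeagre E := by
  obtain ⟨U, hU, hEU⟩ := hE.residualEq_isOpen
  rcases U.eq_empty_or_nonempty with rfl | ⟨⟨k0, l0⟩, h0⟩
  · filter_upwards [hEU.mem_iff] with t ht
    simpa using ht
  exfalso
  obtain ⟨P, Q, hP, hQ, hk0, hl0, hPQ⟩ := isOpen_prod_iff.1 hU k0 l0 h0
  obtain ⟨l, hlQ, hl⟩ := (dense_of_mem_residual
    (eventually_residual_prod hEU.mem_iff)).inter_open_nonempty Q hQ ⟨l0, hl0⟩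
  obtain ⟨k, hkP, hk⟩ := (dense_of_mem_residual
    (inter_mem hl (hs l))).inter_open_nonempty P hP ⟨k0, hk0⟩
  exact hk.2 (hk.1.2 (hPQ ⟨hkP, hlQ⟩))

lemma IsMeagre.preimage_val_closure {K : Type*} [TopologicalSpace K] {O E : Set K} (hO : IsOpen O)
    (hE : IsMeagre E) : IsMeagre ((↑) ⁻¹' E : Set (closure O)) := by
  obtain ⟨S, hSo, hSd, hSc, hSE⟩ := mem_residual_iff.1 hE
  have h : ∀ s ∈ S, ∀ᶠ x : closure O in residual (closure O), (x : K) ∈ s := by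
    intro s hs
    refine residual_of_dense_open ((hSo s hs).preimage continuous_subtype_val) ?_
    rw [dense_iff_inter_open]
    rintro _ ⟨Q, hQ, rfl⟩ ⟨x, hx⟩
    obtain ⟨y, hy⟩ := mem_closure_iff.1 x.2 Q hQ hx
    obtain ⟨z, hz, hzs⟩ := (hSd s hs).inter_open_nonempty _ (hQ.inter hO) ⟨y, hy⟩
    exact ⟨⟨z, subset_closure hz.2⟩, hz.1, hzs⟩
  filter_upwards [(eventually_countable_ball hSc).2 h] with x hx
  exact hSE hx

/-- Witnesses can be made small, so that countably many can be summed: recentre g at a point and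
restrict it to the closure of an open set, where meager sets stay meager. -/
lemma HaarMeager.exists_range_subset {X : Type*} [AddCommGroup X] [TopologicalSpace X]
    [IsTopologicalAddGroup X] [MeasurableSpace X] {C : Set X} (hC : HaarMeager C) {V : Set X}
    (hV : V ∈ 𝓝 0) :
    ∃ B : Set X, MeasurableSet B ∧ C ⊆ B ∧ ∃ (K : Type) (_ : MetricSpace K) (_ : CompactSpace K)
      (_ : Nonempty K) (g : K → X), Continuous g ∧ (∀ k, g k ∈ V) ∧
      ∀ x : X, IsMeagre {k | g k - x ∈ B} := by
  obtain ⟨B, hB, hCB, K, _, _, ⟨k0⟩, g, hg, hm⟩ := hC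
  obtain ⟨W, hW, hWc, hWV⟩ := exists_mem_nhds_isClosed_subset hV
  have hg' : Continuous fun k => g k - g k0 := hg.sub continuous_const
  have hO : IsOpen ((fun k => g k - g k0) ⁻¹' interior W) := isOpen_interior.preimage hg'
  set O := (fun k => g k - g k0) ⁻¹' interior W with hOdef
  refine ⟨B, hB, hCB, closure O, inferInstance, isCompact_iff_compactSpace.1
    isClosed_closure.isCompact, ⟨k0, subset_closure ?_⟩, fun k => g k - g k0,
    hg'.comp continuous_subtype_val, fun k => hWV ?_, fun x => ?_⟩
  · simpa [hOdef, mem_interior_iff_mem_nhds] using hW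
  · exact closure_minimal (t := (fun k => g k - g k0) ⁻¹' W) (fun k hk => interior_subset (s := W) hk) (hWc.preimage hg') k.2
  · have := hm (x + g k0)
    rw [HaarMeager.preimage_image_add] at this
    refine (this.preimage_val_closure hO).mono fun k hk => ?_
    simpa [sub_sub, add_comm] using hk

/-- A nonempty open set is not covered by countably many Haar meager sets. -/
theorem IsOpen.not_subset_iUnion_haarMeager {X : Type*} [AddCommGroup X] [TopologicalSpace X]
    [IsTopologicalAddGroup X] [PolishSpace X] [MeasurableSpace X] [BorelSpace X] {O : Set X}
    (hO : IsOpen O) (hne : O.Nonempty) {C : ℕ → Set X} (hC : ∀ i, HaarMeager (C i)) :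
    ¬ O ⊆ ⋃ i, C i := by
  intro hsub
  obtain ⟨V, hV, hsum⟩ := exists_nhds_forall_exists_continuous_sum X
  choose B hB hCB K hK1 hK2 hK3 g hg hgV hm using fun i => (hC i).exists_range_subset (hV i)
  obtain ⟨G, hG, hGu⟩ := hsum K g hg hgV
  obtain ⟨o, ho⟩ := hne
  let t0 : ∀ i, K i := fun i => (hK3 i).some
  set c := G t0 - o with hc
  -- With all coordinates but the i-th frozen, G is a translate of g i, so every section is meager.
  have hE : ∀ i, IsMeagre {t | G t - c ∈ B i} := by
    intro i
    let e := Homeomorph.piSplitAt i K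
    borelize (K i × (∀ j : { j // j ≠ i }, K j))
    have h1 : MeasurableSet {q | G (e.symm q) - c ∈ B i} :=
      ((hG.comp e.symm.continuous).sub continuous_const).measurable (hB i)
    have h2 : IsMeagre {q | G (e.symm q) - c ∈ B i} := by
      refine h1.baireMeasurableSet.isMeagre_of_sections fun l => ?_
      let t := e.symm (t0 i, l)
      have h3 : ∀ k, e.symm (k, l) = Function.update t i k := by
        intro k
        ext j
        rcases eq_or_ne j i with rfl | hj
        · simp [e, t, Homeomorph.piSplitAt, Equiv.piSplitAt]
        · simp [e, t, hj, Homeomorph.piSplitAt, Equiv.piSplitAt]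
      have := hm i (c + g i (t i) - G t)
      convert this using 3 with k
      simp only [mem_ofPred_eq]
      rw [h3, hGu]
      abel_nf
    have h4 := h2.preimage_of_isOpenMap e.continuous e.isOpenMap
    simpa using h4
  have hop : IsOpen {t | G t - c ∈ O} := hO.preimage (hG.sub continuous_const)
  refine not_isMeagre_of_isOpen hop ⟨t0, by simpa [hc] using ho⟩
    ((isMeagre_iUnion hE).mono fun t ht => ?_)
  obtain ⟨i, hi⟩ := mem_iUnion.1 (hsub ht)
  exact mem_iUnion.2 ⟨i, hCB i hi⟩

/-! ### The group ring of shifts and Djoković's identity -/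

section
variable {X Y : Type*} [AddCommGroup X] [AddCommGroup Y]

/-- The action of the group ring `ℤ[X]` on functions `X → Y` in which `X` acts by shifts. -/
noncomputable def shiftAction (X Y : Type*) [AddCommGroup X] [AddCommGroup Y] :
    AddMonoidAlgebra ℤ X →ₐ[ℤ] Module.End ℤ (X → Y) :=
  AddMonoidAlgebra.lift ℤ (Module.End ℤ (X → Y)) X
    { toFun := fun h => shiftₗ X Y h.toAdd
      map_one' := by ext f x; simp [shiftₗ_apply]
      map_mul' := fun a b => by
        ext f x; simp [shiftₗ_apply, add_assoc] }

/-- The group element `h` seen in the group ring `ℤ[X]`. -/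
noncomputable abbrev shiftElt (h : X) : AddMonoidAlgebra ℤ X := AddMonoidAlgebra.single h 1

lemma shiftElt_add (a b : X) : shiftElt (a + b) = shiftElt a * shiftElt b := by
  simp [shiftElt, AddMonoidAlgebra.single_mul_single]

lemma shiftElt_zero : shiftElt (0 : X) = 1 := rfl

lemma shiftElt_nsmul (n : ℕ) (a : X) : shiftElt (n • a) = shiftElt a ^ n := by
  simp [shiftElt, AddMonoidAlgebra.single_pow]

lemma shiftElt_sum {ι : Type*} (s : Finset ι) (v : ι → X) :
    shiftElt (∑ i ∈ s, v i) = ∏ i ∈ s, shiftElt (v i) := by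
  classical
  induction s using Finset.induction_on with
  | empty => simp [shiftElt_zero]
  | insert i s hi ih => rw [Finset.sum_insert hi, Finset.prod_insert hi, shiftElt_add, ih]

lemma shiftAction_shiftElt (h : X) : shiftAction X Y (shiftElt h) = shiftₗ X Y h := by
  simp [shiftAction, shiftElt]

lemma shiftAction_shiftElt_mul (h : X) (μ : AddMonoidAlgebra ℤ X) (f : X → Y) (x : X) :
    shiftAction X Y (shiftElt h * μ) f x = shiftAction X Y μ f (x + h) := by
  rw [map_mul, shiftAction_shiftElt, Module.End.mul_apply, shiftₗ_apply]

lemma shiftAction_sub_one_pow (h : X) (p : ℕ) (f : X → Y) (x : X) :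
    shiftAction X Y ((shiftElt h - 1) ^ p) f x = (fwdDiff h)^[p] f x := by
  rw [map_pow, map_sub, map_one, shiftAction_shiftElt, shiftₗ, add_sub_cancel_right,
    ← coe_fwdDiffₗ_pow]

/-- Djoković's identity: a product of first differences with arbitrary increments is a
combination of shifted iterated differences. -/
lemma prod_shiftElt_sub_one [Module ℝ X] (p : ℕ) (h : ℕ → X) :
    ∏ i ∈ Finset.range p, (shiftElt (h i) - 1) =
      ∑ e ∈ (Finset.range p).powerset, (-1 : AddMonoidAlgebra ℤ X) ^ e.card *
        (shiftElt (∑ i ∈ e, h i) *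
          (shiftElt (-∑ i ∈ e, ((i : ℝ) + 1)⁻¹ • h i) - 1) ^ p) := by
  have key : ∀ e ∈ (Finset.range p).powerset, (-1 : AddMonoidAlgebra ℤ X) ^ e.card *
        (shiftElt (∑ i ∈ e, h i) *
          (shiftElt (-∑ i ∈ e, ((i : ℝ) + 1)⁻¹ • h i) - 1) ^ p) =
      ∑ j ∈ Finset.range (p + 1), ((-1) ^ (p - j) * (p.choose j : AddMonoidAlgebra ℤ X)) *
        ∏ i ∈ e, (-shiftElt ((1 - (j : ℝ) * ((i : ℝ) + 1)⁻¹) • h i)) := by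
    intro e _
    rw [sub_eq_add_neg, add_pow, Finset.mul_sum, Finset.mul_sum]
    refine Finset.sum_congr rfl fun j _ => ?_
    rw [Finset.prod_neg, ← shiftElt_sum, ← shiftElt_nsmul]
    have : ∑ i ∈ e, (1 - (j : ℝ) * ((i : ℝ) + 1)⁻¹) • h i
        = ∑ i ∈ e, h i + j • (-∑ i ∈ e, ((i : ℝ) + 1)⁻¹ • h i) := by
      rw [smul_neg, Finset.smul_sum, ← sub_eq_add_neg, ← Finset.sum_sub_distrib]
      refine Finset.sum_congr rfl fun i _ => ?_
      rw [sub_smul, one_smul, mul_smul, Nat.cast_smul_eq_nsmul]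
    rw [this, shiftElt_add]
    ring
  rw [Finset.sum_congr rfl key, Finset.sum_comm]
  simp_rw [← Finset.mul_sum, ← Finset.prod_add_one]
  -- The sum over `e` has become a product over i. For 1 ≤ j ≤ p the factor i = j - 1 involves the
  -- shift by (1 - j/(i+1)) h_i = 0 and vanishes, so only j = 0 survives.
  rw [Finset.sum_eq_single_of_mem 0 (by simp)]
  · simp only [tsub_zero, Nat.choose_zero_right, Nat.cast_one, mul_one, Nat.cast_zero, zero_mul,
      one_smul]
    have : ∏ i ∈ Finset.range p, (shiftElt (h i) - 1) =
        ∏ i ∈ Finset.range p, (-(-shiftElt (h i) + 1)) :=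
      Finset.prod_congr rfl fun i _ => by ring
    rw [this, Finset.prod_neg, Finset.card_range]
  · intro j hj hj0
    rw [Finset.prod_eq_zero (i := j - 1), mul_zero]
    · simp at hj ⊢; omega
    · have : ((j - 1 : ℕ) : ℝ) + 1 = j := by
        rw [← Nat.cast_add_one, Nat.sub_add_cancel (Nat.pos_of_ne_zero hj0)]
      rw [this, mul_inv_cancel₀ (Nat.cast_ne_zero.2 hj0), sub_self, zero_smul, shiftElt_zero]
      ring

end

/-! ### Leading parts of local polynomials -/

section
variable {X Y : Type*} [AddCommGroup X] [Module ℝ X] [TopologicalSpace X]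
  [IsTopologicalAddGroup X] [ContinuousSMul ℝ X] [AddCommGroup Y]

/-- Near the origin `f` is a polynomial function of order less than `p`. -/
def LocallyPolynomial (p : ℕ) (f : X → Y) : Prop :=
  ∀ᶠ z : X × X in 𝓝 0, (fwdDiff z.2)^[p] f z.1 = 0

/-- Djoković's identity with p increments `z.2` and one increment `z.1` writes the discrepancy as a
signed sum of (p+1)-st differences with small base points and increments, all zero. -/
lemma LocallyPolynomial.eventually_fwdDiff_iter_eq {p : ℕ} {f : X → Y}
    (hf : LocallyPolynomial (p + 1) f) :
    ∀ᶠ z : X × X in 𝓝 0, (fwdDiff z.2)^[p] f z.1 = (fwdDiff z.2)^[p] f 0 := by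
  let v : X × X → ℕ → X := fun z i => if i < p then z.2 else z.1
  have hv : ∀ i, Continuous fun z => v z i := by
    intro i
    by_cases hi : i < p <;> simp only [v, hi, if_true, if_false] <;> fun_prop
  have hv0 : ∀ i, v 0 i = 0 := by intro i; simp [v]
  have h : ∀ e ∈ (Finset.range (p + 1)).powerset, ∀ᶠ z : X × X in 𝓝 0,
      (fwdDiff (-∑ i ∈ e, ((i : ℝ) + 1)⁻¹ • v z i))^[p + 1] f (0 + ∑ i ∈ e, v z i) = 0 := by
    intro e _
    have hc : Continuous fun z : X × X =>
        ((0 + ∑ i ∈ e, v z i, -∑ i ∈ e, ((i : ℝ) + 1)⁻¹ • v z i) : X × X) := by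
      refine .prodMk (continuous_const.add (continuous_finsetSum _ fun i _ => hv i))
        (continuous_finsetSum _ fun i _ => (hv i).const_smul _).neg
    have ht := hc.tendsto 0
    simp only [hv0, smul_zero, Finset.sum_const_zero, neg_zero, add_zero] at ht
    exact ht.eventually hf
  rw [← Finset.eventually_all] at h
  filter_upwards [h] with z hz
  have key := congrArg (fun μ => shiftAction X Y μ f 0) (prod_shiftElt_sub_one (p + 1) (v z))
  have h1 : ∏ i ∈ Finset.range (p + 1), (shiftElt (v z i) - 1)
      = shiftElt z.1 * (shiftElt z.2 - 1) ^ p - (shiftElt z.2 - 1) ^ p := by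
    rw [Finset.prod_range_succ, Finset.prod_congr rfl
      (g := fun _ => shiftElt z.2 - 1) fun i hi => by simp [v, Finset.mem_range.1 hi]]
    simp [v]
    ring
  have h2 : ∑ e ∈ (Finset.range (p + 1)).powerset, shiftAction X Y
        ((-1 : AddMonoidAlgebra ℤ X) ^ e.card * (shiftElt (∑ i ∈ e, v z i) *
          (shiftElt (-∑ i ∈ e, ((i : ℝ) + 1)⁻¹ • v z i) - 1) ^ (p + 1))) f 0 = 0 := by
    refine Finset.sum_eq_zero fun e he => ?_
    have h3 := hz e he
    rw [← shiftAction_sub_one_pow, ← shiftAction_shiftElt_mul] at h3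
    rcases neg_one_pow_eq_or (AddMonoidAlgebra ℤ X) e.card with h4 | h4 <;> rw [h4]
    · rw [one_mul, h3]
    · rw [neg_one_mul, map_neg]
      simp only [LinearMap.neg_apply, Pi.neg_apply, h3, neg_zero]
  simp only [h1, map_sum, LinearMap.sum_apply, Finset.sum_apply, h2] at key
  rw [map_sub, LinearMap.sub_apply, Pi.sub_apply, shiftAction_shiftElt_mul,
    shiftAction_sub_one_pow, shiftAction_sub_one_pow, zero_add] at key
  exact sub_eq_zero.1 key

/-- With τ the shift by u, (τ^j - 1)^p = (1 + τ + … + τ^(j-1))^p (τ - 1)^p, and each of the j^p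
resulting small shifts leaves the p-th difference unchanged. -/
lemma LocallyPolynomial.eventually_fwdDiff_iter_nsmul {p : ℕ} {f : X → Y}
    (hf : LocallyPolynomial (p + 1) f) (j : ℕ) :
    ∀ᶠ u : X in 𝓝 0, (fwdDiff (j • u))^[p] f 0 = j ^ p • (fwdDiff u)^[p] f 0 := by
  have h : ∀ q k : ℕ, ∀ᶠ u : X in 𝓝 0, shiftAction X Y (shiftElt (k • u) *
      ((∑ i ∈ Finset.range j, shiftElt (i • u)) ^ q * (shiftElt u - 1) ^ p)) f 0
        = j ^ q • (fwdDiff u)^[p] f 0 := by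
    intro q
    induction q with
    | zero =>
      intro k
      have hc : Continuous fun u : X => ((k • u, u) : X × X) := by fun_prop
      have ht := hc.tendsto 0
      rw [smul_zero] at ht
      filter_upwards [ht.eventually hf.eventually_fwdDiff_iter_eq] with u hu
      rw [pow_zero, one_mul, shiftAction_shiftElt_mul, shiftAction_sub_one_pow, zero_add, hu,
        pow_zero, one_smul]
    | succ q ih =>
      intro k
      have hall : ∀ i ∈ Finset.range j, ∀ᶠ u : X in 𝓝 0, shiftAction X Y (shiftElt ((k + i) • u) *
          ((∑ i ∈ Finset.range j, shiftElt (i • u)) ^ q * (shiftElt u - 1) ^ p)) f 0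
            = j ^ q • (fwdDiff u)^[p] f 0 := fun i _ => ih (k + i)
      rw [← Finset.eventually_all] at hall
      filter_upwards [hall] with u hu
      have : shiftElt (k • u) * ((∑ i ∈ Finset.range j, shiftElt (i • u)) ^ (q + 1)
            * (shiftElt u - 1) ^ p)
          = ∑ i ∈ Finset.range j, shiftElt ((k + i) • u) *
            ((∑ i ∈ Finset.range j, shiftElt (i • u)) ^ q * (shiftElt u - 1) ^ p) := by
        simp only [add_smul, shiftElt_add (k • u), mul_assoc]
        rw [← Finset.mul_sum, ← Finset.sum_mul]
        ring
      rw [this, map_sum, LinearMap.sum_apply, Finset.sum_apply, Finset.sum_congr rfl hu,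
        Finset.sum_const, Finset.card_range, ← mul_smul, pow_succ']
  filter_upwards [h p 0] with u hu
  rw [← hu, zero_smul, shiftElt_zero, one_mul, ← mul_pow,
    ← shiftAction_sub_one_pow, shiftElt_nsmul]
  simp only [shiftElt_nsmul]
  rw [geom_sum_mul]

variable [Module ℝ Y]

/-- The leading homogeneous part at the origin of a polynomial function of order `p`. -/
noncomputable def leadingPart (p : ℕ) (f : X → Y) (h : X) : Y :=
  (p.factorial : ℝ)⁻¹ • (fwdDiff h)^[p] f 0

lemma LocallyPolynomial.eventually_leadingPart_nsmul {p : ℕ} {f : X → Y}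
    (hf : LocallyPolynomial (p + 1) f) (j : ℕ) :
    ∀ᶠ u : X in 𝓝 0, leadingPart p f (j • u) = j ^ p • leadingPart p f u := by
  filter_upwards [hf.eventually_fwdDiff_iter_nsmul j] with u hu
  rw [leadingPart, hu, leadingPart, smul_comm]

/-- Expanding both differences in Δ_h^p of the leading part and exchanging the sums gives terms
Δ_{jh}^p f(jx) = j^p Δ_h^p f(0). Their weighted sum is p! Δ_h^p f(0), because the p-th difference of
t^p is p!. -/
lemma LocallyPolynomial.sub_leadingPart {p : ℕ} {f : X → Y}
    (hf : LocallyPolynomial (p + 1) f) : LocallyPolynomial p (f - leadingPart p f) := by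
  have h1 : ∀ j ∈ Finset.range (p + 1), ∀ᶠ z : X × X in 𝓝 0,
      (fwdDiff (j • z.2))^[p] f (j • z.1) = j ^ p • (fwdDiff z.2)^[p] f 0 := by
    intro j _
    have hc : Continuous fun z : X × X => ((j • z.1, j • z.2) : X × X) := by fun_prop
    have ht := hc.tendsto 0
    simp only [Prod.fst_zero, Prod.snd_zero, smul_zero] at ht
    filter_upwards [ht.eventually hf.eventually_fwdDiff_iter_eq,
      continuous_snd.tendsto (0 : X × X) |>.eventually (hf.eventually_fwdDiff_iter_nsmul j)]
      with z hz hz'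
    rw [hz, hz']
  rw [← Finset.eventually_all] at h1
  filter_upwards [h1, hf.eventually_fwdDiff_iter_eq] with z hz hz'
  have hF : (fwdDiff z.2)^[p] (leadingPart p f) z.1 = (fwdDiff z.2)^[p] f 0 := by
    have e1 : leadingPart p f = (p.factorial : ℝ)⁻¹ • fun x => (fwdDiff x)^[p] f 0 := rfl
    have e2 : ∑ i ∈ Finset.range (p + 1), ((-1 : ℤ) ^ (p - i) * (p.choose i)) * (i : ℤ) ^ p
        = p.factorial := by
      have := congrFun (fwdDiff_iter_eq_factorial (R := ℤ) (n := p)) 0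
      rw [fwdDiff_iter_eq_sum_shift] at this
      simpa using this
    rw [e1, fwdDiff_iter_const_smul, Pi.smul_apply, fwdDiff_iter_eq_sum_shift]
    simp only [fwdDiff_iter_eq_sum_shift _ f, zero_add, Finset.smul_sum]
    rw [Finset.sum_comm]
    have e3 : ∀ j ∈ Finset.range (p + 1), ∑ i ∈ Finset.range (p + 1),
        (p.factorial : ℝ)⁻¹ • ((-1 : ℤ) ^ (p - i) * (p.choose i)) •
          ((-1 : ℤ) ^ (p - j) * (p.choose j)) • f (j • (z.1 + i • z.2))
        = (p.factorial : ℝ)⁻¹ • (((-1 : ℤ) ^ (p - j) * (p.choose j)) * (j : ℤ) ^ p) •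
          (fwdDiff z.2)^[p] f 0 := by
      intro j hj
      rw [mul_smul, ← Nat.cast_pow, natCast_zsmul, ← hz j hj, fwdDiff_iter_eq_sum_shift,
        Finset.smul_sum, Finset.smul_sum]
      refine Finset.sum_congr rfl fun i _ => ?_
      rw [smul_comm ((-1 : ℤ) ^ (p - i) * (p.choose i)), smul_add, smul_comm j i]
    rw [Finset.sum_congr rfl e3, ← Finset.smul_sum, ← Finset.sum_smul, e2, natCast_zsmul,
      ← Nat.cast_smul_eq_nsmul ℝ, smul_smul,
      inv_mul_cancel₀ (Nat.cast_ne_zero.2 p.factorial_ne_zero), one_smul,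
      fwdDiff_iter_eq_sum_shift]
    simp
  have : f - leadingPart p f = f + (-1 : ℤ) • leadingPart p f := by simp [sub_eq_add_neg]
  rw [this, fwdDiff_iter_add, fwdDiff_iter_const_smul, Pi.add_apply, Pi.smul_apply, hF, hz']
  simp

end

/-! ### From boundedness on Steinhaus sets to continuity -/

section
variable {X Y : Type*} [AddCommGroup X] [TopologicalSpace X] [AddCommGroup Y] [Module ℝ Y] [TopologicalSpace Y]
  [IsTopologicalAddGroup Y] [ContinuousSMul ℝ Y]

/-- Arbitrarily close to the origin there are Steinhaus sets on which `f` is absorbed by any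
given neighbourhood of `0`. -/
def SteinhausBounded (f : X → Y) : Prop :=
  ∀ V ∈ 𝓝 (0 : Y), ∀ O ∈ 𝓝 (0 : X), ∃ A ⊆ O, SteinhausSet A ∧ ∃ r : ℝ, 0 < r ∧ ∀ a ∈ A, f a ∈ r • V

lemma exists_balanced_nhds_add_subset {W : Set Y} (hW : W ∈ 𝓝 0) :
    ∃ V ∈ 𝓝 (0 : Y), Balanced ℝ V ∧ V + V ⊆ W := by
  obtain ⟨V, hV, hVW⟩ := exists_nhds_zero_half hW
  refine ⟨balancedCore ℝ V, balancedCore_mem_nhds_zero hV, balancedCore_balanced V, ?_⟩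
  rintro _ ⟨a, ha, b, hb, rfl⟩
  exact hVW a (balancedCore_subset V ha) b (balancedCore_subset V hb)

lemma SteinhausBounded.sub_of_eventually {f F : X → Y} (hf : SteinhausBounded f)
    (hF : ∀ W ∈ 𝓝 (0 : Y), ∃ r : ℝ, 0 < r ∧ ∀ᶠ u in 𝓝 (0 : X), F u ∈ r • W) :
    SteinhausBounded (f - F) := by
  intro W hW O hO
  obtain ⟨V, hV, hVb, hVW⟩ := exists_balanced_nhds_add_subset hW
  obtain ⟨r, hr, hrF⟩ := hF V hV
  -- Shrinking `O` first places A where F is already absorbed.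
  obtain ⟨A, hA, hAS, q, hq, hqA⟩ := hf V hV _ (inter_mem hO hrF)
  refine ⟨A, hA.trans inter_subset_left, hAS, max r q, lt_max_of_lt_left hr, fun a ha => ?_⟩
  have h1 : f a ∈ max r q • V := hVb.smul_mono (by
    rw [Real.norm_of_nonneg hq.le, Real.norm_of_nonneg (hq.le.trans (le_max_right _ _))]
    exact le_max_right _ _) (hqA a ha)
  have h2 : -F a ∈ max r q • V := by
    refine (hVb.smul (max r q)).neg_mem_iff.2 ?_
    exact hVb.smul_mono (by
      rw [Real.norm_of_nonneg hr.le, Real.norm_of_nonneg (hr.le.trans (le_max_left _ _))]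
      exact le_max_left _ _) (hA ha).2
  have := add_mem_add h1 h2
  rw [← smul_add] at this
  simpa [sub_eq_add_neg] using smul_set_mono hVW this

variable [Module ℝ X] [IsTopologicalAddGroup X] [ContinuousSMul ℝ X]

/-- Δ_u^p f(0) may be computed at the start a of a progression inside the set where `f` is bounded.
-/
lemma LocallyPolynomial.leadingPart_absorbed {p : ℕ} {f : X → Y}
    (hf : LocallyPolynomial (p + 1) f) (hb : SteinhausBounded f) {W : Set Y} (hW : W ∈ 𝓝 0) :
    ∃ r : ℝ, 0 < r ∧ ∀ᶠ u in 𝓝 (0 : X), leadingPart p f u ∈ r • W := by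
  obtain ⟨V, hV, hVW⟩ : ∃ V ∈ 𝓝 (0 : Y), ∀ y : ℕ → Y, (∀ j ≤ p, y j ∈ V) →
      ∑ j ∈ Finset.range (p + 1), ((-1 : ℤ) ^ (p - j) * p.choose j) • y j ∈ W := by
    have hc : Continuous fun y : Fin (p + 1) → Y =>
        ∑ j : Fin (p + 1), ((-1 : ℤ) ^ (p - (j : ℕ)) * p.choose (j : ℕ)) • y j :=
      continuous_finsetSum _ fun j _ => by fun_prop
    have ht := hc.tendsto 0
    simp only [Pi.zero_apply, smul_zero, Finset.sum_const_zero] at ht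
    have h1 := ht hW
    rw [mem_map, nhds_pi, Filter.mem_pi] at h1
    obtain ⟨I, -, s, hs, hsub⟩ := h1
    refine ⟨⋂ j, s j, iInter_mem.2 hs, fun y hy => ?_⟩
    rw [Finset.sum_range]
    exact @hsub (fun j : Fin (p + 1) => y j) fun j _ => mem_iInter.1 (hy j (Nat.le_of_lt_succ j.2)) j
  obtain ⟨O, hO, U, hU, hOU⟩ := mem_nhds_prod_iff.1 hf.eventually_fwdDiff_iter_eq
  obtain ⟨A, hA, hAS, q, hq, hqA⟩ := hb V hV O hO
  have hfac : (0 : ℝ) < (p.factorial : ℝ)⁻¹ := by positivity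
  refine ⟨(p.factorial : ℝ)⁻¹ * q, by positivity, ?_⟩
  filter_upwards [hAS p, hU] with u ⟨a, ha⟩ hu
  rw [mul_smul]
  refine smul_mem_smul_set ?_
  have ha0 : a ∈ O := by simpa using hA (ha 0 (Nat.zero_le _))
  have h2 : (fwdDiff u)^[p] f a = (fwdDiff u)^[p] f 0 := hOU (mk_mem_prod ha0 hu)
  rw [← h2, fwdDiff_iter_eq_sum_shift]
  rw [mem_smul_set_iff_inv_smul_mem₀ hq.ne', Finset.smul_sum]
  convert hVW (fun j => q⁻¹ • f (a + j • u))
    (fun j hj => (mem_smul_set_iff_inv_smul_mem₀ hq.ne' _ _).1 (hqA _ (ha j hj))) using 2 with j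
  rw [smul_comm]

/-- For m ≥ r, from m^p F(u) = F(mu) ∈ rV one gets F(u) ∈ V, since V is balanced. Degree 0 gives no
such gain, but there the leading part is constant. -/
lemma LocallyPolynomial.continuousAt_leadingPart {p : ℕ} {f : X → Y}
    (hf : LocallyPolynomial (p + 1) f)
    (hF : ∀ W ∈ 𝓝 (0 : Y), ∃ r : ℝ, 0 < r ∧ ∀ᶠ u in 𝓝 (0 : X), leadingPart p f u ∈ r • W) :
    ContinuousAt (leadingPart p f) 0 := by
  rcases Nat.eq_zero_or_pos p with rfl | hp
  · exact continuousAt_const (y := ((0 : ℕ).factorial : ℝ)⁻¹ • f 0)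
  have h0 : leadingPart p f 0 = 0 := by
    have := (hf.eventually_leadingPart_nsmul 0).self_of_nhds
    rwa [zero_smul, zero_pow hp.ne', zero_smul] at this
  rw [ContinuousAt, h0, tendsto_def]
  intro W hW
  obtain ⟨V, hV, hVb, hVW⟩ := exists_balanced_nhds_add_subset hW
  have hVW' : V ⊆ W := fun v hv => hVW ⟨v, hv, 0, mem_of_mem_nhds hV, add_zero v⟩
  obtain ⟨r, hr, hrV⟩ := hF V hV
  obtain ⟨m, hm⟩ := exists_nat_ge r
  have hm0 : (0 : ℝ) < m := hr.trans_le hm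
  have ht : Tendsto (fun u : X => m • u) (𝓝 0) (𝓝 0) := by
    simpa using (continuous_nsmul (M := X) m).tendsto 0
  filter_upwards [ht.eventually hrV, hf.eventually_leadingPart_nsmul m] with u hu hu'
  rw [hu'] at hu
  have h1 : r ≤ (m : ℝ) ^ p := hm.trans (le_self_pow₀ (by exact_mod_cast hm0) hp.ne')
  have h2 : m ^ p • leadingPart p f u ∈ (m : ℝ) ^ p • V := hVb.smul_mono (by
    rwa [Real.norm_of_nonneg hr.le, Real.norm_of_nonneg (by positivity)]) hu
  rw [← Nat.cast_smul_eq_nsmul ℝ, Nat.cast_pow,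
    smul_mem_smul_set_iff₀ (pow_ne_zero _ hm0.ne')] at h2
  exact hVW' h2

theorem LocallyPolynomial.continuousAt {p : ℕ} {f : X → Y} (hf : LocallyPolynomial p f)
    (hb : SteinhausBounded f) : ContinuousAt f 0 := by
  induction p generalizing f with
  | zero =>
    have h1 : ∀ᶠ x : X in 𝓝 0, f x = 0 := by
      have ht : Tendsto (fun x : X => ((x, 0) : X × X)) (𝓝 0) (𝓝 0) :=
        (Continuous.prodMk continuous_id continuous_const).tendsto 0
      exact ht.eventually hf
    exact (continuousAt_const (y := (0 : Y))).congr (h1.mono fun x hx => hx.symm)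
  | succ p ih =>
    have hF := fun W hW => hf.leadingPart_absorbed hb (W := W) hW
    have h := (ih hf.sub_leadingPart (hb.sub_of_eventually hF)).add
      (hf.continuousAt_leadingPart hF)
    exact h.congr (Eventually.of_forall fun x => by simp)

end

/-! ### Covers by 𝒟-measurable sets and the theorem -/

lemma SteinhausSet.mono {X : Type*} [AddCommGroup X] [TopologicalSpace X] {A B : Set X}
    (hA : SteinhausSet A) (h : A ⊆ B) : SteinhausSet B := fun p =>
  (hA p).mono fun _ ⟨a, ha⟩ => ⟨a, fun j hj => h (ha j hj)⟩

lemma SteinhausSet.preimage_add {X : Type*} [AddCommGroup X] [TopologicalSpace X] {A : Set X}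
    (hA : SteinhausSet A) (c : X) : SteinhausSet ((fun x => c + x) ⁻¹' A) := fun p =>
  (hA p).mono fun _ ⟨a, ha⟩ => ⟨a - c, fun j hj => by
    have := ha j hj
    rw [mem_preimage]
    convert this using 1
    abel⟩

/-- Among countably many `𝒟`-measurable sets covering a nonempty open set, one contains a
Steinhaus subset of the open set. -/
lemma exists_steinhausSet_inter {X : Type*} [AddCommGroup X]
    [TopologicalSpace X] [IsTopologicalAddGroup X] [PolishSpace X] [MeasurableSpace X]
    [BorelSpace X] {O : Set X} (hO : IsOpen O) (hne : O.Nonempty) {C : ℕ → Set X}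
    (hC : ∀ i, DMeasurableSet (C i)) (hcov : O ⊆ ⋃ i, C i) : ∃ i, SteinhausSet (O ∩ C i) := by
  by_contra! hcon
  choose B M hB hM hBM using hC
  have h1 : ∀ i, HaarMeager (O ∩ B i) := fun i =>
    (hO.measurableSet.inter (hB i)).haarMeager_of_not_steinhausSet fun h =>
      hcon i (h.mono (inter_subset_inter_right _ (by rw [hBM i]; exact subset_union_left)))
  refine hO.not_subset_iUnion_haarMeager hne
    (C := fun k => Sum.elim (fun i => O ∩ B i) M (Equiv.natSumNatEquivNat.symm k)) (fun k => ?_)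
    fun x hx => ?_
  · rcases Equiv.natSumNatEquivNat.symm k with i | i
    · exact h1 i
    · exact hM i
  · obtain ⟨i, hi⟩ := mem_iUnion.1 (hcov hx)
    rw [hBM i] at hi
    rcases hi with hi | hi
    · exact mem_iUnion.2 ⟨Equiv.natSumNatEquivNat (.inl i), by
        rw [Equiv.symm_apply_apply]; exact ⟨hx, hi⟩⟩
    · exact mem_iUnion.2 ⟨Equiv.natSumNatEquivNat (.inr i), by
        rw [Equiv.symm_apply_apply]; exact hi⟩

theorem mainTheorem2
    {X : Type*} [AddCommGroup X] [Module ℝ X] [TopologicalSpace X]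
    [IsTopologicalAddGroup X] [ContinuousSMul ℝ X] [PolishSpace X]
    [MeasurableSpace X] [BorelSpace X]
    {Y : Type*} [AddCommGroup Y] [Module ℝ Y] [TopologicalSpace Y]
    [IsTopologicalAddGroup Y] [ContinuousSMul ℝ Y]
    (D : Set X) (hDne : D.Nonempty) (hDopen : IsOpen D) (hDconv : Convex ℝ D)
    (n : ℕ) (f : D → Y) (hmeas : DMeasurable f) (hpoly : IsPolynomialFunction n f) :
    Continuous f := by
  classical
  rw [continuous_iff_continuousAt]
  intro c
  -- The value 0 off `D` is harmless: only the germ of F at the origin is used.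
  let F : X → Y := fun x => if h : (c : X) + x ∈ D then f ⟨c + x, h⟩ else 0
  have hF : ∀ x (h : (c : X) + x ∈ D), F x = f ⟨c + x, h⟩ := fun x h => dif_pos h
  have hp : LocallyPolynomial (n + 1) F := by
    have h1 : ∀ i : Fin (n + 2), ∀ᶠ z : X × X in 𝓝 0, c + z.1 + (i : ℕ) • z.2 ∈ D := by
      intro i
      have hc : Continuous fun z : X × X => c + z.1 + (i : ℕ) • z.2 := by fun_prop
      refine hc.tendsto 0 (hDopen.mem_nhds ?_)
      simp
    filter_upwards [eventually_all.2 h1] with z hz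
    rw [fwdDiff_iter_eq_sum_shift, Finset.sum_range, ← hpoly (c + z.1) z.2 hz]
    refine Finset.sum_congr rfl fun i _ => ?_
    rw [hF _ (by rw [← add_assoc]; exact hz i)]
    simp only [add_assoc]
  have hb : SteinhausBounded F := by
    intro V hV O hO
    obtain ⟨W, hWV, hW, hW0⟩ := mem_nhds_iff.1 hV
    have hP : D ∩ (fun x => x - (c : X)) ⁻¹' interior O ∈ 𝓝 (c : X) := by
      refine inter_mem (hDopen.mem_nhds c.2) ((isOpen_interior.preimage (by fun_prop)).mem_nhds ?_)
      simpa [mem_interior_iff_mem_nhds] using hO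
    obtain ⟨P, hPsub, hP, hcP⟩ := mem_nhds_iff.1 hP
    obtain ⟨i, hi⟩ := exists_steinhausSet_inter hP ⟨c, hcP⟩
      -- The factor i + 1 is never 0, so each multiple of W is open; W is absorbent, so the
      -- multiples cover `Y`.
      (C := fun i : ℕ => Subtype.val '' (f ⁻¹' (((i : ℝ) + 1) • W)))
      (fun i => hmeas _ (hW.smul₀ (by positivity))) fun x hx => by
        have habs : Absorbent ℝ W := absorbent_nhds_zero (hW.mem_nhds hW0)
        obtain ⟨r, hr⟩ := (habs (f ⟨x, (hPsub hx).1⟩)).exists_pos |>.imp fun r h => h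
        obtain ⟨i, hi⟩ := exists_nat_ge r
        refine mem_iUnion.2 ⟨i, ⟨x, (hPsub hx).1⟩, ?_, rfl⟩
        have := hr.2 ((i : ℝ) + 1) (by
          rw [Real.norm_of_nonneg (by positivity)]; linarith)
        exact this rfl
    refine ⟨_, ?_, hi.preimage_add (c : X), (i : ℝ) + 1, by positivity, ?_⟩
    · intro x hx
      simpa using interior_subset (hPsub hx.1).2
    · rintro x ⟨-, y, hy, hyx⟩
      have hxD : (c : X) + x ∈ D := by
        have h : (y : X) = c + x := hyx
        exact h ▸ y.2
      rw [hF x hxD]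
      have : y = ⟨c + x, hxD⟩ := Subtype.ext hyx
      rw [← this]
      exact smul_set_mono hWV hy
  have hcont := hp.continuousAt hb
  have ht : Tendsto (fun x : D => (x : X) - c) (𝓝 c) (𝓝 0) := by
    have : Continuous fun x : D => (x : X) - c := by fun_prop
    simpa using this.tendsto c
  have h2 := hcont.tendsto.comp ht
  have h3 : F ∘ (fun x : D => (x : X) - c) = f := by
    ext x
    simp only [Function.comp_apply]
    rw [hF _ (by simp)]
    congr 1
    ext
    simp
  have h4 : F 0 = f c := by rw [hF 0 (by simp)]; simp
  rwa [h3, h4] at h2
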